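/- For $n\ge1$ and a permutation $\sigma=\sigma_1\cdots\sigma_n\in\mathfrak S_n$, set $\sigma_0=\sigma_{n+1}=0$ and let $\mathrm{V}(\sigma)$, $\mathrm{M}(\sigma)$, $\mathrm{da}(\sigma)$, $\mathrm{dd}(\sigma)$ be the numbers of indices $i\in\{1,\dots,n\}$ with, respectively, $\sigma_{i-1}>\sigma_i<\sigma_{i+1}$ (valleys), $\sigma_{i-1}<\sigma_i>\sigma_{i+1}$ (peaks), $\sigma_{i-1}<\sigma_i<\sigma_{i+1}$ (double ascents), $\sigma_{i-1}>\sigma_i>\sigma_{i+1}$ (double descents). Let $\mathrm{lma}(\sigma)$ and $\mathrm{rma}(\sigma)$ be the numbers of left-to-right maxima and of right-to-left maxima of $\sigma$, and put $$P_n(u_1,u_2,u_3,u_4|\alpha,\beta)=\sum_{\sigma\in\mathfrak S_n}u_1^{\mathrm V(\sigma)}u_2^{\mathrm M(\sigma)-1}u_3^{\mathrm{da}(\sigma)}u_4^{\mathrm{dd}(\sigma)}\alpha^{\mathrm{lma}(\sigma)-1}\beta^{\mathrm{rma}(\sigma)-1}.$$ Theorem (Ji's formula). Let $u_1,u_2,u_3,u_4,\alpha,\beta,x,y$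 be elements of a field of characteristic zero (for example, of a field of rational functions) with $x\ne y$, $x+y=u_3+u_4$ and $xy=u_1u_2$, and let $$F(x,y;t)=\frac{e^{xt}-e^{yt}}{xe^{yt}-ye^{xt}}.$$ Then, as formal power series in $t$, $$\sum_{n\ge0}P_{n+1}(u_1,u_2,u_3,u_4|\alpha,\beta)\frac{t^n}{n!}=\bigl(1+yF(x,y;t)\bigr)^{\frac{\alpha+\beta}2}\bigl(1+xF(x,y;t)\bigr)^{\frac{\alpha+\beta}2}e^{\frac12(\beta-\alpha)(u_4-u_3)t}$$ and $$\sum_{n\ge0}P_{n+1}(u_1,u_2,u_3,u_4|\alpha,\beta)\frac{t^n}{n!}=e^{(u_3\alpha+u_4\beta)t}\left(\frac{x-y}{xe^{yt}-ye^{xt}}\right)^{\alpha+\beta}.$$ Here $f^{a}=\exp(a\log f)$ for a formal power series $f$ with constant term $1$. -/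

import Mathlib

open PowerSeries

/-- The letter `σ_i` (`1 ≤ i ≤ n`, values `1, …, n`) of the word of a permutation of an `n`-element
set, with the boundary condition `σ_0 = σ_{n+1} = 0`. -/
def letterAt {n : ℕ} (σ : Equiv.Perm (Fin n)) (i : ℕ) : ℕ :=
  if h : 1 ≤ i ∧ i ≤ n then (σ ⟨i - 1, by omega⟩ : ℕ) + 1 else 0

/-- Number of peaks `σ_{i-1} < σ_i > σ_{i+1}`, `1 ≤ i ≤ n`, boundary values `0`. -/
def peaks {n : ℕ} (σ : Equiv.Perm (Fin n)) : ℕ :=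
  ((Finset.Icc 1 n).filter fun i =>
    letterAt σ (i - 1) < letterAt σ i ∧ letterAt σ (i + 1) < letterAt σ i).card

/-- Number of valleys `σ_{i-1} > σ_i < σ_{i+1}`, `1 ≤ i ≤ n`, boundary values `0`. -/
def valleys {n : ℕ} (σ : Equiv.Perm (Fin n)) : ℕ :=
  ((Finset.Icc 1 n).filter fun i =>
    letterAt σ i < letterAt σ (i - 1) ∧ letterAt σ i < letterAt σ (i + 1)).card

/-- Number of double ascents `σ_{i-1} < σ_i < σ_{i+1}`, `1 ≤ i ≤ n`, boundary values `0`. -/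
def doubleAscents {n : ℕ} (σ : Equiv.Perm (Fin n)) : ℕ :=
  ((Finset.Icc 1 n).filter fun i =>
    letterAt σ (i - 1) < letterAt σ i ∧ letterAt σ i < letterAt σ (i + 1)).card

/-- Number of double descents `σ_{i-1} > σ_i > σ_{i+1}`, `1 ≤ i ≤ n`, boundary values `0`. -/
def doubleDescents {n : ℕ} (σ : Equiv.Perm (Fin n)) : ℕ :=
  ((Finset.Icc 1 n).filter fun i =>
    letterAt σ i < letterAt σ (i - 1) ∧ letterAt σ (i + 1) < letterAt σ i).card

/-- Number of left-to-right maxima. -/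
def leftToRightMaxima {n : ℕ} (σ : Equiv.Perm (Fin n)) : ℕ :=
  ((Finset.univ : Finset (Fin n)).filter fun i => ∀ j, j < i → σ j < σ i).card

/-- Number of right-to-left maxima. -/
def rightToLeftMaxima {n : ℕ} (σ : Equiv.Perm (Fin n)) : ℕ :=
  ((Finset.univ : Finset (Fin n)).filter fun i => ∀ j, i < j → σ j < σ i).card

/-- `P_n(u₁,u₂,u₃,u₄|α,β)`. For `n ≥ 1` every permutation has at least one peak, one left-to-right
maximum and one right-to-left maximum, so the subtractions in the exponents are genuine. -/
def jiPoly {R : Type*} [CommSemiring R] (n : ℕ) (u₁ u₂ u₃ u₄ α β : R) : R :=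
  ∑ σ : Equiv.Perm (Fin n),
    u₁ ^ valleys σ * u₂ ^ (peaks σ - 1) * u₃ ^ doubleAscents σ * u₄ ^ doubleDescents σ *
      α ^ (leftToRightMaxima σ - 1) * β ^ (rightToLeftMaxima σ - 1)

/-- The formal power series `e^{ct}` in the variable `t`. -/
noncomputable def expSeries {K : Type*} [Field K] [CharZero K] (c : K) : K⟦X⟧ :=
  rescale c (PowerSeries.exp K)

/-- `F(x,y;t) = (e^{xt} - e^{yt}) / (x e^{yt} - y e^{xt})`, for `x ≠ y` (the denominator has
constant term `x - y`). -/
noncomputable def eulerF {K : Type*} [Field K] [CharZero K] (x y : K) : K⟦X⟧ :=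
  (expSeries x - expSeries y) * (C x * expSeries y - C y * expSeries x)⁻¹

/-- The power `f ^ a = exp (a log f)` of a formal power series `f` with constant term `1`, with an
exponent `a` in the coefficient field. -/
noncomputable def seriesPow {K : Type*} [Field K] [CharZero K] (f : K⟦X⟧) (a : K) : K⟦X⟧ :=
  (PowerSeries.exp K).subst (C a * logOf f)

/-! Every word on `n + 1` letters arises once from a word on `n` letters by inserting a new smallest
letter into a gap. At the left end this adds a double ascent and a left-to-right maximum (factor `α
u₃`); at the right end, symmetrically, the factor is `β u₄`. In an interior gap the new letter is a
valley, and only the smaller neighbour changes type: a valley becomes a double descent or a double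
ascent, a double ascent or double descent becomes a peak. Hence (`jiPoly_succ_succ`) `P_{n+2} = (α
u₃ + β u₄) P_{n+1} + d P_{n+1}` for any derivation with `d u₁ = (u₃ + u₄) u₁`, `d u₂ = 0`, `d u₃ = d
u₄ = u₁ u₂`, `d α = d β = 0`.

This grammar is realised by `d/dt` on power series `U₁, …, U₄` with constant terms `u₁, …, u₄`,
built from `F` by means of `F' = (1 + xF)(1 + yF)`. If `G' = (α U₃ + β U₄) G` and `G(0) = 1`, then
`G⁽ⁿ⁾ = P_{n+1}(U) G`; at `t = 0` this identifies `G` with the generating function. Both right-hand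
sides solve this linear equation. -/

/-! ### Logarithmic derivatives of formal powers, and the differential equation of `F` -/

section FormalSeries

variable {K : Type*} [Field K] [CharZero K]

theorem derivative_expSeries (c : K) : d⁄dX K (expSeries c) = C c * expSeries c := by
  have h : HasSubst (C c * X : K⟦X⟧) := HasSubst.of_constantCoeff_zero' (by simp)
  have e : expSeries c = (PowerSeries.exp K).subst (C c * X : K⟦X⟧) := by
    rw [expSeries, rescale_eq_subst, smul_eq_C_mul]
  rw [e, derivative_subst h, derivative_exp]
  simp [Derivation.leibniz, mul_comm]

theorem constantCoeff_expSeries (c : K) : constantCoeff (expSeries c) = 1 := by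
  rw [← coeff_zero_eq_constantCoeff_apply, expSeries, coeff_rescale]
  simp

theorem derivative_logOf_mul {f : K⟦X⟧} (hf : constantCoeff f = 1) :
    d⁄dX K (logOf f) * f = d⁄dX K f := by
  have h : HasSubst (f - 1) := HasSubst.of_constantCoeff_zero' (by simp [hf])
  have hgeom : (d⁄dX K (PowerSeries.log K)) * (1 + X) = 1 := by
    rw [deriv_log]
    ext n
    rcases n with _ | n
    · simp [mul_add]
    · simp [mul_add, coeff_one, coeff_succ_mul_X, pow_succ]
  have hs := congrArg (subst (f - 1)) hgeom
  rw [subst_mul h, subst_add h, subst_X h] at hs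
  have h1 : subst (f - 1) (1 : K⟦X⟧) = (1 : K⟦X⟧) := by
    rw [← coe_substAlgHom h, map_one]
  rw [h1, add_sub_cancel] at hs
  rw [logOf_eq, derivative_subst h, map_sub, Derivation.map_one_eq_zero, sub_zero]
  linear_combination (d⁄dX K f) * hs

theorem constantCoeff_seriesPow {f : K⟦X⟧} (hf : constantCoeff f = 1) (a : K) :
    constantCoeff (seriesPow f a) = 1 := by
  have h0 : constantCoeff (C a * logOf f) = 0 := by simp [constantCoeff_logOf hf]
  have h : HasSubst (C a * logOf f) := HasSubst.of_constantCoeff_zero' h0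
  have : PowerSeries.exp K = 1 + (PowerSeries.exp K - 1) := by ring
  have h1 : subst (C a * logOf f) (1 : K⟦X⟧) = (1 : K⟦X⟧) := by
    rw [← coe_substAlgHom h, map_one]
  have h2 : constantCoeff (subst (C a * logOf f) (PowerSeries.exp K - 1)) = 0 :=
    constantCoeff_subst_eq_zero h0 _ (by simp)
  rw [seriesPow, this, subst_add h, h1, map_add, h2]
  simp

/-- If `f' = g f`, then `(f ^ a)' = a g f ^ a`. -/
theorem derivative_seriesPow {f g : K⟦X⟧} (hf : constantCoeff f = 1)
    (hd : d⁄dX K f = g * f) (a : K) :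
    d⁄dX K (seriesPow f a) = C a * g * seriesPow f a := by
  have h : HasSubst (C a * logOf f) :=
    HasSubst.of_constantCoeff_zero' (by simp [constantCoeff_logOf hf])
  have hl : d⁄dX K (logOf f) = g := by
    have hne : f ≠ 0 := by rintro rfl; simp at hf
    exact mul_right_cancel₀ hne ((derivative_logOf_mul hf).trans hd)
  rw [seriesPow, derivative_subst h, derivative_exp]
  simp only [Derivation.leibniz, derivative_C, hl, smul_eq_mul]
  ring

section EulerF

variable {x y : K}

theorem eulerDenom_mul_inv (hxy : x ≠ y) :
    (C x * expSeries y - C y * expSeries x) * (C x * expSeries y - C y * expSeries x)⁻¹ = 1 :=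
  PowerSeries.mul_inv_cancel _ (by simpa [constantCoeff_expSeries, sub_eq_zero] using hxy)

theorem one_add_left_mul_eulerF (hxy : x ≠ y) : 1 + C x * eulerF x y =
    C (x - y) * (C x * expSeries y - C y * expSeries x)⁻¹ * expSeries x := by
  rw [eulerF, map_sub]
  linear_combination -eulerDenom_mul_inv hxy

theorem one_add_right_mul_eulerF (hxy : x ≠ y) : 1 + C y * eulerF x y =
    C (x - y) * (C x * expSeries y - C y * expSeries x)⁻¹ * expSeries y := by
  rw [eulerF, map_sub]
  linear_combination -eulerDenom_mul_inv hxy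

theorem constantCoeff_eulerF : constantCoeff (eulerF x y) = 0 := by
  simp [eulerF, constantCoeff_expSeries]

theorem constantCoeff_eulerQuotient (hxy : x ≠ y) :
    constantCoeff (C (x - y) * (C x * expSeries y - C y * expSeries x)⁻¹) = 1 := by
  simp [constantCoeff_expSeries, sub_ne_zero.mpr hxy]

/-- The denominator has derivative `-xy (e^{xt} - e^{yt})`, so the logarithmic derivative of the
quotient is `xyF`. -/
theorem derivative_eulerQuotient :
    d⁄dX K (C (x - y) * (C x * expSeries y - C y * expSeries x)⁻¹) =
      C x * C y * eulerF x y * (C (x - y) * (C x * expSeries y - C y * expSeries x)⁻¹) := by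
  simp only [eulerF, Derivation.leibniz, derivative_C, derivative_inv', map_sub, smul_eq_mul,
    derivative_expSeries]
  ring

/-- By the quotient rule both sides equal `(x - y)² e^{(x+y)t}` over the square of the denominator.
-/
theorem derivative_eulerF (hxy : x ≠ y) :
    d⁄dX K (eulerF x y) = (1 + C x * eulerF x y) * (1 + C y * eulerF x y) := by
  have h := eulerDenom_mul_inv hxy
  rw [one_add_left_mul_eulerF hxy, one_add_right_mul_eulerF hxy]
  simp only [eulerF, Derivation.leibniz, derivative_C, derivative_inv', map_sub, smul_eq_mul,
    derivative_expSeries]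
  linear_combination -((C x * expSeries x - C y * expSeries y) *
    (C x * expSeries y - C y * expSeries x)⁻¹) * h

end EulerF

end FormalSeries

/-! ### Insertion of a smallest letter and its effect on the statistics -/

section Insertion

/-- Insert a new smallest letter at position `k` of the word of `σ`. -/
def insertMin {n : ℕ} (k : Fin (n + 1)) (σ : Equiv.Perm (Fin n)) : Equiv.Perm (Fin (n + 1)) :=
  (finSuccEquiv' k).trans ((Equiv.optionCongr σ).trans (finSuccEquiv' 0).symm)

@[simp]
theorem insertMin_self {n : ℕ} (k : Fin (n + 1)) (σ : Equiv.Perm (Fin n)) :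
    insertMin k σ k = 0 := by
  simp [insertMin]

@[simp]
theorem insertMin_succAbove {n : ℕ} (k : Fin (n + 1)) (σ : Equiv.Perm (Fin n)) (j : Fin n) :
    insertMin k σ (k.succAbove j) = (σ j).succ := by
  simp [insertMin]

theorem insertMin_bijective (n : ℕ) :
    Function.Bijective fun p : Fin (n + 1) × Equiv.Perm (Fin n) => insertMin p.1 p.2 := by
  rw [Fintype.bijective_iff_injective_and_card]
  constructor
  · rintro ⟨k, σ⟩ ⟨l, τ⟩ h
    dsimp only at h
    have hkl : k = l := by
      apply (insertMin k σ).injective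
      rw [insertMin_self, h, insertMin_self]
    subst hkl
    refine Prod.ext rfl (Equiv.ext fun j => ?_)
    have := congrArg (fun ρ => ρ (k.succAbove j)) h
    simpa using this
  · simp [Fintype.card_perm, Nat.factorial_succ]

variable {n : ℕ}

theorem letterAt_zero (σ : Equiv.Perm (Fin n)) : letterAt σ 0 = 0 := by simp [letterAt]

theorem letterAt_of_lt (σ : Equiv.Perm (Fin n)) {i : ℕ} (h : n < i) : letterAt σ i = 0 := by
  rw [letterAt, dif_neg (by omega)]

theorem letterAt_succ (σ : Equiv.Perm (Fin n)) (i : Fin n) : letterAt σ (i + 1) = σ i + 1 := by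
  rw [letterAt, dif_pos (by omega)]
  simp

theorem letterAt_pos (σ : Equiv.Perm (Fin n)) {i : ℕ} (h : 1 ≤ i) (h' : i ≤ n) :
    0 < letterAt σ i := by
  rw [letterAt, dif_pos ⟨h, h'⟩]
  omega

theorem letterAt_ne_letterAt_succ (σ : Equiv.Perm (Fin n)) (hn : 1 ≤ n) {i : ℕ} (h : i ≤ n) :
    letterAt σ i ≠ letterAt σ (i + 1) := by
  rcases Nat.eq_zero_or_pos i with rfl | hi
  · rw [letterAt_zero]
    exact (letterAt_pos σ le_rfl hn).ne
  rcases h.eq_or_lt with rfl | h'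
  · rw [letterAt_of_lt σ (Nat.lt_succ_self i)]
    exact (letterAt_pos σ hi le_rfl).ne'
  · obtain ⟨j, rfl⟩ : ∃ j, i = j + 1 := ⟨i - 1, by omega⟩
    have h1 := letterAt_succ σ ⟨j, by omega⟩
    have h2 := letterAt_succ σ ⟨j + 1, h'⟩
    simp only at h1 h2
    rw [h1, h2]
    intro h3
    have h4 : σ ⟨j, by omega⟩ = σ ⟨j + 1, h'⟩ := Fin.ext (by omega)
    simpa using σ.injective h4

/-- The effect on a letter (or on a boundary value `0`) of making room for a new smallest letter. -/
def bump (a : ℕ) : ℕ := if a = 0 then 0 else a + 1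

theorem bump_lt_bump {a b : ℕ} : bump a < bump b ↔ a < b := by
  unfold bump
  split_ifs <;> omega

theorem letterAt_insertMin_of_le (k : Fin (n + 1)) (σ : Equiv.Perm (Fin n)) {i : ℕ} (h : i ≤ k) :
    letterAt (insertMin k σ) i = bump (letterAt σ i) := by
  rcases Nat.eq_zero_or_pos i with rfl | hi
  · simp [letterAt_zero, bump]
  obtain ⟨j, rfl⟩ : ∃ j, i = j + 1 := ⟨i - 1, by omega⟩
  have h1 := letterAt_succ σ ⟨j, by omega⟩
  have h2 := letterAt_succ (insertMin k σ) (k.succAbove ⟨j, by omega⟩)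
  rw [insertMin_succAbove, Fin.succAbove_of_castSucc_lt _ _ (by rw [Fin.lt_def]; simpa using h)] at h2
  simp only [Fin.val_castSucc, Fin.val_succ] at h1 h2
  rw [h1, h2]
  simp [bump]

theorem letterAt_insertMin_self (k : Fin (n + 1)) (σ : Equiv.Perm (Fin n)) :
    letterAt (insertMin k σ) (k + 1) = 1 := by
  simp [letterAt_succ]

theorem letterAt_insertMin_of_lt (k : Fin (n + 1)) (σ : Equiv.Perm (Fin n)) {i : ℕ} (h : k < i) :
    letterAt (insertMin k σ) (i + 1) = bump (letterAt σ i) := by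
  rcases lt_or_ge n i with hi | hi
  · simp [letterAt_of_lt σ hi, letterAt_of_lt (insertMin k σ) (Nat.succ_lt_succ hi), bump]
  obtain ⟨j, rfl⟩ : ∃ j, i = j + 1 := ⟨i - 1, by omega⟩
  have h1 := letterAt_succ σ ⟨j, by omega⟩
  have h2 := letterAt_succ (insertMin k σ) (k.succAbove ⟨j, by omega⟩)
  rw [insertMin_succAbove, Fin.succAbove_of_le_castSucc _ _
    (by rw [Fin.le_def]; simpa using Nat.lt_succ_iff.mp h)] at h2
  simp only [Fin.val_succ] at h1 h2
  rw [h1, h2]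
  simp [bump]

/-- Only the positions next to the gap matter: two old ones (`k`, `k + 1`) are replaced by three new
ones. Boundary positions, where the predicates fail, are included in the sums so that the end gaps
need no separate treatment. -/
theorem card_filter_Icc_insert (p q : ℕ → Prop) [DecidablePred p] [DecidablePred q] {n k : ℕ}
    (hk : k ≤ n) (p0 : ¬ p 0) (pn : ¬ p (n + 1)) (q0 : ¬ q 0) (qn : ¬ q (n + 2))
    (hlt : ∀ i < k, q i ↔ p i) (hgt : ∀ i, k + 2 ≤ i → (q (i + 1) ↔ p i)) :
    ((Finset.Icc 1 (n + 1)).filter q).card + (if p k then 1 else 0) + (if p (k + 1) then 1 else 0) =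
      ((Finset.Icc 1 n).filter p).card + (if q k then 1 else 0) + (if q (k + 1) then 1 else 0) +
        (if q (k + 2) then 1 else 0) := by
  have key : ∀ (r : ℕ → Prop) [DecidablePred r] (m : ℕ), ¬ r 0 → ¬ r (m + 1) →
      ((Finset.Icc 1 m).filter r).card = ∑ i ∈ Finset.range (m + 2), if r i then 1 else 0 := by
    intro r _ m h0 hm
    rw [Finset.sum_range_succ, if_neg hm, ← Finset.card_filter, add_zero]
    refine congrArg Finset.card (Finset.ext fun i => ?_)
    simp only [Finset.mem_filter, Finset.mem_Icc, Finset.mem_range]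
    constructor
    · rintro ⟨h, h'⟩
      exact ⟨by omega, h'⟩
    · rintro ⟨h, h'⟩
      have : i ≠ 0 := by rintro rfl; exact h0 h'
      exact ⟨by omega, h'⟩
  obtain ⟨m, rfl⟩ := Nat.exists_eq_add_of_le hk
  rw [key q _ q0 qn, key p _ p0 pn, show k + m + 1 + 2 = (k + 3) + m by ring,
    show k + m + 2 = (k + 2) + m by ring, Finset.sum_range_add _ (k + 3) m,
    Finset.sum_range_add _ (k + 2) m]
  simp only [Finset.sum_range_succ]
  have e1 : (∑ i ∈ Finset.range k, if q i then 1 else 0) =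
      ∑ i ∈ Finset.range k, if p i then 1 else 0 :=
    Finset.sum_congr rfl fun i hi => by simp only [hlt i (Finset.mem_range.mp hi)]
  have e2 : (∑ i ∈ Finset.range m, if q (k + 3 + i) then 1 else 0) =
      ∑ i ∈ Finset.range m, if p (k + 2 + i) then 1 else 0 :=
    Finset.sum_congr rfl fun i _ => by
      rw [show k + 3 + i = (k + 2 + i) + 1 by ring]
      simp only [hgt (k + 2 + i) (by omega)]
  rw [e1, e2]
  ring

/-- Effect of `insertMin` on the number of positions whose letter forms, together with its two
neighbours, a pattern `ρ` depending on comparisons only. -/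
theorem card_pattern_insertMin (ρ : ℕ → ℕ → ℕ → Prop) [∀ a b c, Decidable (ρ a b c)]
    (hρ : ∀ a b c, ρ (bump a) (bump b) (bump c) ↔ ρ a b c) (hl : ∀ c, ¬ ρ 0 0 c)
    (hr : ∀ a, ¬ ρ a 0 0) (k : Fin (n + 1)) (σ : Equiv.Perm (Fin n)) :
    ((Finset.Icc 1 (n + 1)).filter fun i => ρ (letterAt (insertMin k σ) (i - 1))
        (letterAt (insertMin k σ) i) (letterAt (insertMin k σ) (i + 1))).card +
      (if ρ (letterAt σ (k - 1)) (letterAt σ k) (letterAt σ (k + 1)) then 1 else 0) +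
      (if ρ (letterAt σ k) (letterAt σ (k + 1)) (letterAt σ (k + 2)) then 1 else 0) =
    ((Finset.Icc 1 n).filter fun i =>
        ρ (letterAt σ (i - 1)) (letterAt σ i) (letterAt σ (i + 1))).card +
      (if ρ (bump (letterAt σ (k - 1))) (bump (letterAt σ k)) 1 then 1 else 0) +
      (if ρ (bump (letterAt σ k)) 1 (bump (letterAt σ (k + 1))) then 1 else 0) +
      (if ρ 1 (bump (letterAt σ (k + 1))) (bump (letterAt σ (k + 2))) then 1 else 0) := by
  have h := card_filter_Icc_insert
    (fun i => ρ (letterAt σ (i - 1)) (letterAt σ i) (letterAt σ (i + 1)))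
    (fun i => ρ (letterAt (insertMin k σ) (i - 1)) (letterAt (insertMin k σ) i)
      (letterAt (insertMin k σ) (i + 1))) (Fin.is_le k)
    (by simp [letterAt_zero, hl])
    (by simp [letterAt_of_lt σ (show n < n + 1 by omega),
          letterAt_of_lt σ (show n < n + 1 + 1 by omega), hr])
    (by simp [letterAt_zero, hl])
    (by simp [letterAt_of_lt (insertMin k σ) (show n + 1 < n + 2 by omega),
          letterAt_of_lt (insertMin k σ) (show n + 1 < n + 2 + 1 by omega), hr])
    (fun i hi => by
      rw [letterAt_insertMin_of_le k σ (show i - 1 ≤ k by omega),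
        letterAt_insertMin_of_le k σ (show i ≤ k by omega),
        letterAt_insertMin_of_le k σ (show i + 1 ≤ k by omega), hρ])
    (fun i hi => by
      obtain ⟨j, rfl⟩ : ∃ j, i = j + 1 := ⟨i - 1, by omega⟩
      rw [Nat.add_sub_cancel, Nat.add_sub_cancel, letterAt_insertMin_of_lt k σ (by omega),
        letterAt_insertMin_of_lt k σ (by omega), letterAt_insertMin_of_lt k σ (by omega), hρ])
  simp only [Nat.add_sub_cancel, show (k : ℕ) + 2 - 1 = k + 1 by omega] at h
  rw [letterAt_insertMin_self, letterAt_insertMin_of_le k σ (Nat.sub_le _ 1),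
    letterAt_insertMin_of_le k σ le_rfl, letterAt_insertMin_of_lt k σ (Nat.lt_succ_self _),
    show (k : ℕ) + 2 + 1 = (k + 2) + 1 from rfl,
    letterAt_insertMin_of_lt k σ (show (k : ℕ) < k + 2 by omega)] at h
  exact h

/-- A smallest letter never prevents another letter from being a record, and is one itself only in
first position. -/
theorem leftToRightMaxima_insertMin (k : Fin (n + 1)) (σ : Equiv.Perm (Fin n)) :
    leftToRightMaxima (insertMin k σ) = leftToRightMaxima σ + if k = 0 then 1 else 0 := by
  rw [leftToRightMaxima, leftToRightMaxima, Finset.card_filter, Finset.card_filter,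
    Fin.sum_univ_succAbove _ k, add_comm]
  congr 1
  · refine Finset.sum_congr rfl fun j _ => if_congr ?_ rfl rfl
    rw [Fin.forall_iff_succAbove k]
    simp [Fin.succ_pos]
  · refine if_congr ?_ rfl rfl
    simp only [insertMin_self, Fin.not_lt_zero, imp_false, not_lt]
    exact ⟨fun h => Fin.le_zero_iff.mp (h 0), fun h j => h ▸ Fin.zero_le j⟩

theorem rightToLeftMaxima_insertMin (k : Fin (n + 1)) (σ : Equiv.Perm (Fin n)) :
    rightToLeftMaxima (insertMin k σ) =
      rightToLeftMaxima σ + if k = Fin.last n then 1 else 0 := by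
  rw [rightToLeftMaxima, rightToLeftMaxima, Finset.card_filter, Finset.card_filter,
    Fin.sum_univ_succAbove _ k, add_comm]
  congr 1
  · refine Finset.sum_congr rfl fun j _ => if_congr ?_ rfl rfl
    rw [Fin.forall_iff_succAbove k]
    simp [Fin.succ_pos]
  · refine if_congr ?_ rfl rfl
    simp only [insertMin_self, Fin.not_lt_zero, imp_false, not_lt]
    exact ⟨fun h => Fin.last_le_iff.mp (h _), fun h j => h ▸ Fin.le_last j⟩

theorem one_le_leftToRightMaxima (σ : Equiv.Perm (Fin (n + 1))) : 1 ≤ leftToRightMaxima σ :=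
  Finset.card_pos.mpr ⟨0, by simp⟩

theorem one_le_rightToLeftMaxima (σ : Equiv.Perm (Fin (n + 1))) : 1 ≤ rightToLeftMaxima σ :=
  Finset.card_pos.mpr ⟨Fin.last n, by simp [Fin.le_last]⟩

theorem letterAt_le (σ : Equiv.Perm (Fin n)) (i : ℕ) : letterAt σ i ≤ n := by
  unfold letterAt
  split_ifs <;> omega

/-- The largest letter is a peak. -/
theorem one_le_peaks (σ : Equiv.Perm (Fin (n + 1))) : 1 ≤ peaks σ := by
  refine Finset.card_pos.mpr ⟨(σ.symm (Fin.last n) : ℕ) + 1, ?_⟩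
  have h := letterAt_succ σ (σ.symm (Fin.last n))
  rw [Equiv.apply_symm_apply, Fin.val_last] at h
  have h1 := letterAt_ne_letterAt_succ σ (by omega) (σ.symm (Fin.last n)).is_le'
  have h2 := letterAt_ne_letterAt_succ σ (by omega) (i := (σ.symm (Fin.last n) : ℕ) + 1) (by omega)
  have h3 := letterAt_le σ (σ.symm (Fin.last n) : ℕ)
  have h4 := letterAt_le σ ((σ.symm (Fin.last n) : ℕ) + 1 + 1)
  simp only [Finset.mem_filter, Finset.mem_Icc, Nat.add_sub_cancel]
  omega

end Insertion

/-! ### The recurrence as a derivation -/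

section Recurrence

variable {n : ℕ}

/-- The two end gaps, then the interior gaps sorted by the type of the smaller neighbour: the left
one at an ascent, the right one at a descent. Each case decides all six indicators, so that exactly
one summand survives in `sum_jiTerm_insertMin`. -/
theorem statistics_insertMin (hn : 1 ≤ n) (k : Fin (n + 1)) (σ : Equiv.Perm (Fin n)) :
    let a₀ := letterAt σ (k - 1)
    let a := letterAt σ k
    let b := letterAt σ (k + 1)
    let b₁ := letterAt σ (k + 2)
    let V := a < a₀ ∧ a < b
    let A := a₀ < a ∧ a < b
    let V' := b < a ∧ b < b₁
    let D' := b < a ∧ b₁ < b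
    let τ := insertMin k σ
    (k = 0 ∧ k ≠ Fin.last n ∧ ¬ V ∧ ¬ A ∧ ¬ V' ∧ ¬ D' ∧ valleys τ = valleys σ ∧
      peaks τ = peaks σ ∧ doubleAscents τ = doubleAscents σ + 1 ∧
      doubleDescents τ = doubleDescents σ) ∨
    (k ≠ 0 ∧ k = Fin.last n ∧ ¬ V ∧ ¬ A ∧ ¬ V' ∧ ¬ D' ∧ valleys τ = valleys σ ∧
      peaks τ = peaks σ ∧ doubleAscents τ = doubleAscents σ ∧
      doubleDescents τ = doubleDescents σ + 1) ∨
    (k ≠ 0 ∧ k ≠ Fin.last n ∧ V ∧ ¬ A ∧ ¬ V' ∧ ¬ D' ∧ valleys τ = valleys σ ∧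
      peaks τ = peaks σ ∧ doubleAscents τ = doubleAscents σ ∧
      doubleDescents τ = doubleDescents σ + 1) ∨
    (k ≠ 0 ∧ k ≠ Fin.last n ∧ ¬ V ∧ A ∧ ¬ V' ∧ ¬ D' ∧ valleys τ = valleys σ + 1 ∧
      peaks τ = peaks σ + 1 ∧ doubleAscents τ + 1 = doubleAscents σ ∧
      doubleDescents τ = doubleDescents σ) ∨
    (k ≠ 0 ∧ k ≠ Fin.last n ∧ ¬ V ∧ ¬ A ∧ V' ∧ ¬ D' ∧ valleys τ = valleys σ ∧
      peaks τ = peaks σ ∧ doubleAscents τ = doubleAscents σ + 1 ∧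
      doubleDescents τ = doubleDescents σ) ∨
    (k ≠ 0 ∧ k ≠ Fin.last n ∧ ¬ V ∧ ¬ A ∧ ¬ V' ∧ D' ∧ valleys τ = valleys σ + 1 ∧
      peaks τ = peaks σ + 1 ∧ doubleAscents τ = doubleAscents σ ∧
      doubleDescents τ + 1 = doubleDescents σ) := by
  intro a₀ a b b₁ V A V' D' τ
  have hV : valleys τ + _ + _ = valleys σ + _ + _ + _ :=
    card_pattern_insertMin (fun a b c => b < a ∧ b < c)
      (by simp [bump_lt_bump]) (by simp) (by simp) k σ
  have hM : peaks τ + _ + _ = peaks σ + _ + _ + _ :=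
    card_pattern_insertMin (fun a b c => a < b ∧ c < b)
      (by simp [bump_lt_bump]) (by simp) (by simp) k σ
  have hA : doubleAscents τ + _ + _ = doubleAscents σ + _ + _ + _ :=
    card_pattern_insertMin (fun a b c => a < b ∧ b < c)
      (by simp [bump_lt_bump]) (by simp) (by simp) k σ
  have hD : doubleDescents τ + _ + _ = doubleDescents σ + _ + _ + _ :=
    card_pattern_insertMin (fun a b c => b < a ∧ c < b)
      (by simp [bump_lt_bump]) (by simp) (by simp) k σ
  have hk := k.is_le
  have hab : a ≠ b := letterAt_ne_letterAt_succ σ hn hk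
  -- For `k = 0` the truncated index `k - 1` is `0`, hence `a₀ = a` and every strict comparison of
  -- the two fails.
  have h0 : (k : ℕ) = 0 → a₀ = 0 ∧ a = 0 ∧ 0 < b := fun h => by
    simp only [a₀, a, b, h]
    exact ⟨letterAt_zero σ, letterAt_zero σ, letterAt_pos σ le_rfl hn⟩
  have h0' : (k : ℕ) ≠ 0 → 0 < a ∧ a₀ ≠ a := fun h => by
    refine ⟨letterAt_pos σ (by omega) hk, ?_⟩
    have := letterAt_ne_letterAt_succ σ hn (show (k : ℕ) - 1 ≤ n by omega)
    rwa [Nat.sub_add_cancel (by omega)] at this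
  have hl : (k : ℕ) = n → b = 0 ∧ b₁ = 0 :=
    fun h => ⟨letterAt_of_lt σ (by omega), letterAt_of_lt σ (by omega)⟩
  have hl' : (k : ℕ) ≠ n → 0 < b ∧ b ≠ b₁ := fun h =>
    ⟨letterAt_pos σ (by omega) (by omega), letterAt_ne_letterAt_succ σ hn (by omega)⟩
  rw [ne_eq, ne_eq, Fin.ext_iff, Fin.ext_iff, Fin.val_last, Fin.val_zero]
  change valleys τ + (if a < a₀ ∧ a < b then 1 else 0) + (if b < a ∧ b < b₁ then 1 else 0) =
    valleys σ + (if bump a < bump a₀ ∧ bump a < 1 then 1 else 0) +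
    (if 1 < bump a ∧ 1 < bump b then 1 else 0) +
    (if bump b < 1 ∧ bump b < bump b₁ then 1 else 0) at hV
  change peaks τ + (if a₀ < a ∧ b < a then 1 else 0) + (if a < b ∧ b₁ < b then 1 else 0) =
    peaks σ + (if bump a₀ < bump a ∧ 1 < bump a then 1 else 0) +
    (if bump a < 1 ∧ bump b < 1 then 1 else 0) +
    (if 1 < bump b ∧ bump b₁ < bump b then 1 else 0) at hM
  change doubleAscents τ + (if a₀ < a ∧ a < b then 1 else 0) + (if a < b ∧ b < b₁ then 1 else 0) =
    doubleAscents σ + (if bump a₀ < bump a ∧ bump a < 1 then 1 else 0) +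
    (if bump a < 1 ∧ 1 < bump b then 1 else 0) +
    (if 1 < bump b ∧ bump b < bump b₁ then 1 else 0) at hA
  change doubleDescents τ + (if a < a₀ ∧ b < a then 1 else 0) + (if b < a ∧ b₁ < b then 1 else 0) =
    doubleDescents σ + (if bump a < bump a₀ ∧ 1 < bump a then 1 else 0) +
    (if 1 < bump a ∧ bump b < 1 then 1 else 0) +
    (if bump b < 1 ∧ bump b₁ < bump b then 1 else 0) at hD
  have one_lt : ∀ c, 1 < bump c ↔ 0 < c := fun c => by unfold bump; split_ifs <;> omega
  have lt_one : ∀ c, bump c < 1 ↔ c = 0 := fun c => by unfold bump; split_ifs <;> omega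
  simp only [bump_lt_bump, one_lt, lt_one] at hV hM hA hD
  simp only [V, A, V', D']
  clear_value a₀ a b b₁
  rcases eq_or_ne (k : ℕ) 0 with h | h
  · obtain ⟨rfl, rfl, hb⟩ := h0 h
    grind
  rcases eq_or_ne (k : ℕ) n with h' | h'
  · obtain ⟨rfl, rfl⟩ := hl h'
    grind
  clear h0 hl
  rcases hab.lt_or_gt with h2 | h2
  · rcases (h0' h).2.lt_or_gt with h3 | h3
    · grind
    · grind
  · rcases (hl' h').2.lt_or_gt with h3 | h3
    · grind
    · grind

theorem sum_fin_ite_eq_card_nsmul {R : Type*} [AddCommMonoid R] (p : ℕ → Prop) [DecidablePred p]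
    (h0 : ¬ p 0) (c : R) :
    (∑ k : Fin (n + 1), if p k then c else 0) = ((Finset.Icc 1 n).filter p).card • c := by
  rw [Fin.sum_univ_eq_sum_range (fun k => if p k then c else 0), ← Finset.sum_filter,
    Finset.sum_const]
  congr 2
  ext i
  simp only [Finset.mem_filter, Finset.mem_Icc, Finset.mem_range]
  constructor
  · rintro ⟨h, h'⟩
    have : i ≠ 0 := by rintro rfl; exact h0 h'
    exact ⟨by omega, h'⟩
  · rintro ⟨h, h'⟩
    exact ⟨by omega, h'⟩

theorem sum_fin_ite_succ_eq_card_nsmul {R : Type*} [AddCommMonoid R] (p : ℕ → Prop)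
    [DecidablePred p] (h0 : ¬ p 0) (hn : ¬ p (n + 1)) (c : R) :
    (∑ k : Fin (n + 1), if p (k + 1) then c else 0) = ((Finset.Icc 1 n).filter p).card • c := by
  rw [← sum_fin_ite_eq_card_nsmul p h0, Fin.sum_univ_eq_sum_range (fun k => if p k then c else 0),
    Fin.sum_univ_eq_sum_range (fun k => if p (k + 1) then c else 0)]
  have h := Finset.sum_range_succ (fun k => if p k then c else 0) (n + 1)
  rw [Finset.sum_range_succ' _ (n + 1), if_neg h0, if_neg hn, add_zero, add_zero] at h
  exact h

/-- The contribution of a single permutation to `jiPoly`. -/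
def jiTerm {R : Type*} [CommSemiring R] (u₁ u₂ u₃ u₄ α β : R) (σ : Equiv.Perm (Fin n)) : R :=
  u₁ ^ valleys σ * u₂ ^ (peaks σ - 1) * u₃ ^ doubleAscents σ * u₄ ^ doubleDescents σ *
    α ^ (leftToRightMaxima σ - 1) * β ^ (rightToLeftMaxima σ - 1)

variable {S R : Type*} [CommSemiring S] [CommRing R] [Algebra S R] (d : Derivation S R R)
  {u₁ u₂ u₃ u₄ α β : R}

/-- Each interior gap is charged to its smaller neighbour. A valley is charged from both sides,
giving `u₃ + u₄`; a double ascent only from its right and a double descent only from its left, each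
letter `u₃` or `u₄` being replaced by `u₁ u₂`; a peak never. This is the Leibniz rule for `d` on a
monomial. -/
theorem sum_jiTerm_insertMin (h₁ : d u₁ = (u₃ + u₄) * u₁) (h₂ : d u₂ = 0) (h₃ : d u₃ = u₁ * u₂)
    (h₄ : d u₄ = u₁ * u₂) (hα : d α = 0) (hβ : d β = 0) (σ : Equiv.Perm (Fin (n + 1))) :
    ∑ k, jiTerm u₁ u₂ u₃ u₄ α β (insertMin k σ) =
      (α * u₃ + β * u₄) * jiTerm u₁ u₂ u₃ u₄ α β σ + d (jiTerm u₁ u₂ u₃ u₄ α β σ) := by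
  set T := jiTerm u₁ u₂ u₃ u₄ α β σ with hT
  -- `A` and `D` are the weights after a double ascent, respectively a double descent, has become a
  -- peak.
  set A := u₁ ^ (valleys σ + 1) * u₂ ^ (peaks σ - 1 + 1) * u₃ ^ (doubleAscents σ - 1) *
    u₄ ^ doubleDescents σ * α ^ (leftToRightMaxima σ - 1) * β ^ (rightToLeftMaxima σ - 1) with hA
  set D := u₁ ^ (valleys σ + 1) * u₂ ^ (peaks σ - 1 + 1) * u₃ ^ doubleAscents σ *
    u₄ ^ (doubleDescents σ - 1) * α ^ (leftToRightMaxima σ - 1) * β ^ (rightToLeftMaxima σ - 1)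
    with hD
  have key : ∀ k : Fin (n + 2), jiTerm u₁ u₂ u₃ u₄ α β (insertMin k σ) =
      (if k = 0 then α * u₃ * T else 0) + (if k = Fin.last (n + 1) then β * u₄ * T else 0) +
      (if letterAt σ k < letterAt σ (k - 1) ∧ letterAt σ k < letterAt σ (k + 1)
        then u₄ * T else 0) +
      (if letterAt σ (k - 1) < letterAt σ k ∧ letterAt σ k < letterAt σ (k + 1)
        then A else 0) +
      (if letterAt σ (k + 1) < letterAt σ (k + 1 - 1) ∧
          letterAt σ (k + 1) < letterAt σ (k + 1 + 1) then u₃ * T else 0) +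
      (if letterAt σ (k + 1) < letterAt σ (k + 1 - 1) ∧
          letterAt σ (k + 1 + 1) < letterAt σ (k + 1) then D else 0) := by
    intro k
    have hM := one_le_peaks σ
    have hl := Nat.sub_add_comm (k := 1) (m := 1) (one_le_leftToRightMaxima σ)
    have hr := Nat.sub_add_comm (k := 1) (m := 1) (one_le_rightToLeftMaxima σ)
    have hM' := Nat.sub_add_comm (k := 1) (m := 1) hM
    rw [Nat.add_sub_cancel, jiTerm, leftToRightMaxima_insertMin, rightToLeftMaxima_insertMin]
    rcases statistics_insertMin (by omega) k σ with
      ⟨h, h', e₁, e₂, e₃, e₄, v, m, a, b⟩ | ⟨h, h', e₁, e₂, e₃, e₄, v, m, a, b⟩ |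
      ⟨h, h', e₁, e₂, e₃, e₄, v, m, a, b⟩ | ⟨h, h', e₁, e₂, e₃, e₄, v, m, a, b⟩ |
      ⟨h, h', e₁, e₂, e₃, e₄, v, m, a, b⟩ | ⟨h, h', e₁, e₂, e₃, e₄, v, m, a, b⟩
    · simp only [if_pos h, if_neg h', if_neg e₁, if_neg e₂, if_neg e₃, if_neg e₄, v, m, a, b, hT,
        jiTerm, hl, add_zero]
      ring
    · simp only [if_neg h, if_pos h', if_neg e₁, if_neg e₂, if_neg e₃, if_neg e₄, v, m, a, b, hT,
        jiTerm, hr, add_zero]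
      ring
    · simp only [if_neg h, if_neg h', if_pos e₁, if_neg e₂, if_neg e₃, if_neg e₄, v, m, a, b, hT,
        jiTerm, add_zero]
      ring
    · simp only [if_neg h, if_neg h', if_neg e₁, if_pos e₂, if_neg e₃, if_neg e₄, v, m, b, hA,
        hM', add_zero, zero_add, ← a, Nat.add_sub_cancel]
    · simp only [if_neg h, if_neg h', if_neg e₁, if_neg e₂, if_pos e₃, if_neg e₄, v, m, a, b, hT,
        jiTerm, add_zero]
      ring
    · simp only [if_neg h, if_neg h', if_neg e₁, if_neg e₂, if_neg e₃, if_pos e₄, v, m, a, hD,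
        hM', add_zero, zero_add, ← b, Nat.add_sub_cancel]
  rw [Finset.sum_congr rfl fun k _ => key k]
  simp only [Finset.sum_add_distrib, Finset.sum_ite_eq', Finset.mem_univ, if_true]
  have z0 := letterAt_zero σ
  have z1 := letterAt_of_lt σ (show n + 1 < n + 1 + 1 by omega)
  have z2 := letterAt_of_lt σ (show n + 1 < n + 1 + 1 + 1 by omega)
  rw [sum_fin_ite_eq_card_nsmul (fun k => letterAt σ k < letterAt σ (k - 1) ∧
      letterAt σ k < letterAt σ (k + 1)) (by simp),
    sum_fin_ite_eq_card_nsmul (fun k => letterAt σ (k - 1) < letterAt σ k ∧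
      letterAt σ k < letterAt σ (k + 1)) (by simp),
    sum_fin_ite_succ_eq_card_nsmul (fun k => letterAt σ k < letterAt σ (k - 1) ∧
      letterAt σ k < letterAt σ (k + 1)) (by simp) (by simp [z1, z2]),
    sum_fin_ite_succ_eq_card_nsmul (fun k => letterAt σ k < letterAt σ (k - 1) ∧
      letterAt σ (k + 1) < letterAt σ k) (by simp) (by simp [z1, z2])]
  change _ + _ + valleys σ • _ + doubleAscents σ • _ + valleys σ • _ + doubleDescents σ • _ = _
  -- The exponent is truncated when there are no valleys, but the coefficient then vanishes.
  have hv : (valleys σ : R) * u₁ ^ (valleys σ - 1) * u₁ = valleys σ * u₁ ^ valleys σ := by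
    rcases Nat.eq_zero_or_pos (valleys σ) with h | h
    · simp [h]
    · rw [mul_assoc, pow_sub_one_mul h.ne']
  simp only [hT, hA, hD, jiTerm, Derivation.leibniz, Derivation.leibniz_pow, h₁, h₂, h₃, h₄, hα, hβ,
    smul_eq_mul, nsmul_eq_mul, mul_zero, zero_add]
  linear_combination (-(u₃ + u₄) * u₂ ^ (peaks σ - 1) * u₃ ^ doubleAscents σ *
    u₄ ^ doubleDescents σ * α ^ (leftToRightMaxima σ - 1) * β ^ (rightToLeftMaxima σ - 1)) * hv

theorem jiPoly_succ_succ (h₁ : d u₁ = (u₃ + u₄) * u₁) (h₂ : d u₂ = 0) (h₃ : d u₃ = u₁ * u₂)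
    (h₄ : d u₄ = u₁ * u₂) (hα : d α = 0) (hβ : d β = 0) (n : ℕ) :
    jiPoly (n + 2) u₁ u₂ u₃ u₄ α β =
      (α * u₃ + β * u₄) * jiPoly (n + 1) u₁ u₂ u₃ u₄ α β + d (jiPoly (n + 1) u₁ u₂ u₃ u₄ α β) := by
  change ∑ σ, jiTerm u₁ u₂ u₃ u₄ α β σ = _ * (∑ σ, jiTerm u₁ u₂ u₃ u₄ α β σ) +
    d (∑ σ, jiTerm u₁ u₂ u₃ u₄ α β σ)
  rw [← (insertMin_bijective (n + 1)).sum_comp, Fintype.sum_prod_type_right, map_sum,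
    Finset.mul_sum, ← Finset.sum_add_distrib]
  exact Finset.sum_congr rfl fun σ _ => sum_jiTerm_insertMin d h₁ h₂ h₃ h₄ hα hβ σ

theorem jiPoly_one : jiPoly 1 u₁ u₂ u₃ u₄ α β = 1 := by
  have hp : ∀ σ : Equiv.Perm (Fin 1), valleys σ = 0 ∧ peaks σ = 1 ∧ doubleAscents σ = 0 ∧
      doubleDescents σ = 0 ∧ leftToRightMaxima σ = 1 ∧ rightToLeftMaxima σ = 1 := by decide
  simp [jiPoly, hp]

theorem map_jiPoly {R' : Type*} [CommSemiring R'] (f : R →+* R') (n : ℕ) :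
    f (jiPoly n u₁ u₂ u₃ u₄ α β) = jiPoly n (f u₁) (f u₂) (f u₃) (f u₄) (f α) (f β) := by
  simp [jiPoly]

theorem iterate_derivation_eq_jiPoly_mul (h₁ : d u₁ = (u₃ + u₄) * u₁) (h₂ : d u₂ = 0)
    (h₃ : d u₃ = u₁ * u₂) (h₄ : d u₄ = u₁ * u₂) (hα : d α = 0) (hβ : d β = 0) {G : R}
    (hG : d G = (α * u₃ + β * u₄) * G) (n : ℕ) :
    d^[n] G = jiPoly (n + 1) u₁ u₂ u₃ u₄ α β * G := by
  induction n with
  | zero => simp [jiPoly_one]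
  | succ n ih =>
    rw [Function.iterate_succ_apply', ih, Derivation.leibniz, hG,
      jiPoly_succ_succ d h₁ h₂ h₃ h₄ hα hβ]
    simp only [smul_eq_mul]
    ring

end Recurrence

/-! ### Realisation of the grammar by power series -/

section Main

variable {K : Type*} [Field K] [CharZero K] {u₁ u₂ u₃ u₄ α β x y : K}

theorem mk_jiPoly_eq_of_derivative_eq (hxy : x ≠ y) (hadd : x + y = u₃ + u₄)
    (hmul : x * y = u₁ * u₂) {G : K⟦X⟧} (hG0 : constantCoeff G = 1)
    (hG : d⁄dX K G = (C (u₃ * α + u₄ * β) + C (α + β) * (C x * C y * eulerF x y)) * G) :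
    PowerSeries.mk (fun n => jiPoly (n + 1) u₁ u₂ u₃ u₄ α β / (n.factorial : K)) = G := by
  have hF := derivative_eulerF hxy
  have hF0 : constantCoeff (eulerF x y) = 0 := constantCoeff_eulerF
  have hadd' : (C x + C y : K⟦X⟧) = C u₃ + C u₄ := by rw [← map_add, hadd, map_add]
  have hmul' : (C x * C y : K⟦X⟧) = C u₁ * C u₂ := by rw [← map_mul, hmul, map_mul]
  -- Here `U₁ = u₁ F'` and `U₃`, `U₄` are `u₃`, `u₄` shifted by `xyF`. The grammar holds since `F''
  -- = (x + y + 2xyF) F'`, with `x + y = u₃ + u₄` and `xy = u₁ u₂`.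
  have hit := iterate_derivation_eq_jiPoly_mul (d⁄dX K)
    (u₁ := C u₁ * ((1 + C x * eulerF x y) * (1 + C y * eulerF x y))) (u₂ := C u₂)
    (u₃ := C u₃ + C x * C y * eulerF x y) (u₄ := C u₄ + C x * C y * eulerF x y)
    (α := C α) (β := C β) (G := G)
    (by
      simp only [Derivation.leibniz, map_add, Derivation.map_one_eq_zero, derivative_C, hF,
        smul_eq_mul]
      linear_combination (C u₁ * (1 + C x * eulerF x y) * (1 + C y * eulerF x y)) * hadd')
    derivative_C
    (by
      simp only [Derivation.leibniz, map_add, derivative_C, hF, smul_eq_mul]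
      linear_combination ((1 + C x * eulerF x y) * (1 + C y * eulerF x y)) * hmul')
    (by
      simp only [Derivation.leibniz, map_add, derivative_C, hF, smul_eq_mul]
      linear_combination ((1 + C x * eulerF x y) * (1 + C y * eulerF x y)) * hmul')
    derivative_C derivative_C
    (by
      rw [hG]
      simp only [map_add, map_mul]
      ring)
  ext n
  -- At `t = 0`, `F` vanishes, so the series specialise to the given constants.
  have h := congrArg constantCoeff (hit n)
  rw [constantCoeff_iterate_derivative, map_mul, hG0, mul_one, map_jiPoly] at h
  simp only [map_add, map_mul, map_one, constantCoeff_C, hF0, mul_zero, add_zero, mul_one] at h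
  rw [coeff_mk, div_eq_iff (Nat.cast_ne_zero.mpr n.factorial_ne_zero), ← h, mul_comm]

end Main

theorem theorem1 {K : Type*} [Field K] [CharZero K] (u₁ u₂ u₃ u₄ α β x y : K)
    (hxy : x ≠ y) (hadd : x + y = u₃ + u₄) (hmul : x * y = u₁ * u₂) :
    PowerSeries.mk (fun n => jiPoly (n + 1) u₁ u₂ u₃ u₄ α β / (n.factorial : K)) =
        seriesPow (1 + C y * eulerF x y) ((α + β) / 2) *
          seriesPow (1 + C x * eulerF x y) ((α + β) / 2) *
          expSeries ((β - α) * (u₄ - u₃) / 2) ∧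
      PowerSeries.mk (fun n => jiPoly (n + 1) u₁ u₂ u₃ u₄ α β / (n.factorial : K)) =
        expSeries (u₃ * α + u₄ * β) *
          seriesPow (C (x - y) * (C x * expSeries y - C y * expSeries x)⁻¹) (α + β) := by
  have hF := derivative_eulerF hxy
  have hF0 : constantCoeff (eulerF x y) = 0 := constantCoeff_eulerF
  have hQ0 := constantCoeff_eulerQuotient hxy
  have hx0 : constantCoeff (1 + C x * eulerF x y) = 1 := by simp [hF0]
  have hy0 : constantCoeff (1 + C y * eulerF x y) = 1 := by simp [hF0]
  constructor
  · have hx := derivative_seriesPow (g := C x * (1 + C y * eulerF x y)) hx0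
      (by
        simp only [Derivation.leibniz, map_add, Derivation.map_one_eq_zero, derivative_C, hF,
          smul_eq_mul]
        ring) ((α + β) / 2)
    have hy := derivative_seriesPow (g := C y * (1 + C x * eulerF x y)) hy0
      (by
        simp only [Derivation.leibniz, map_add, Derivation.map_one_eq_zero, derivative_C, hF,
          smul_eq_mul]
        ring) ((α + β) / 2)
    refine mk_jiPoly_eq_of_derivative_eq hxy hadd hmul ?_ ?_
    · rw [map_mul, map_mul, constantCoeff_seriesPow hx0, constantCoeff_seriesPow hy0,
        constantCoeff_expSeries, one_mul, one_mul]
    -- The logarithmic derivatives of `1 + xF` and `1 + yF` add up to `x + y + 2xyF`; the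
    -- exponential factor corrects the constant part to `u₃ α + u₄ β`.
    · have e₁ : (C ((α + β) / 2) * (C x + C y) + C ((β - α) * (u₄ - u₃) / 2) : K⟦X⟧) =
          C (u₃ * α + u₄ * β) := by
        rw [← map_add, ← map_mul, ← map_add, hadd]
        congr 1
        ring
      have e₂ : (C ((α + β) / 2) + C ((α + β) / 2) : K⟦X⟧) = C (α + β) := by
        rw [← map_add, add_halves]
      simp only [Derivation.leibniz, hx, hy, derivative_expSeries, smul_eq_mul]
      rw [← e₁, ← e₂]
      ring
  · refine mk_jiPoly_eq_of_derivative_eq hxy hadd hmul ?_ ?_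
    · rw [map_mul, constantCoeff_seriesPow hQ0, constantCoeff_expSeries, one_mul]
    · rw [Derivation.leibniz, derivative_seriesPow hQ0 derivative_eulerQuotient,
        derivative_expSeries]
      simp only [smul_eq_mul]
      ring
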